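/- Let $s,t\ge 1$, $n:=2^s-1$, and let $\gamma$ be a primitive element of $\mathbb F_{2^s}$. Let $\boldsymbol x$ be a codeword of the primitive binary BCH code of length $n$, i.e. the cyclic binary code with zeroes $\gamma,\gamma^3,\dots,\gamma^{2t-1}$ and their conjugates, let $\boldsymbol e\in\mathbb F_2^n$ and $\boldsymbol y=\boldsymbol x+\boldsymbol e$. Put $S_j:=y(\gamma^j)$, where $y(X)=y_0+y_1X+\dots+y_{n-1}X^{n-1}$, and $S(X):=S_1+S_2X+\dots+S_{2t}X^{2t-1}$. Let $I:=\{\gamma^i : e_i\ne 0\}\subseteq \mathbb F_{2^s}^*$ be the set of erroneous coordinates, $\varepsilon:=|I|$, and $\sigma(X):=\prod_{\alpha\in I}(1+\alpha X)$. For a polynomial $f$ write $f(X)=f_{\rm even}(X^2)+Xf_{\rm odd}(X^2)$, and let $\mu:\mathbb F_{2^s}[X]^2\to\mathbb F_{2^s}[X]$ be the bijection $\mu(u,v):=v(X^2)+Xu(X^2)$, with inverse $f\mapsto(f_{\rm odd},f_{\rm even})$. Let $$N:=\Big\{(u,v)\in\mathbb F_{2^s}[X]^2 : u\equiv \frac{S_{\rm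 even}(X)}{1+XS_{\rm odd}(X)}\,v \bmod X^t\Big\}.$$ Let $<_{-1}$ be the monomial ordering on $\mathbb F_{2^s}[X]^2$ in which $(X^i,0)<_{-1}(X^j,0)$ iff $i<j$, $(0,X^i)<_{-1}(0,X^j)$ iff $i<j$, and $(X^i,0)<_{-1}(0,X^j)$ iff $i\le j-1$. Let $\{\boldsymbol h_1=(h_{10},h_{11}),\boldsymbol h_2=(h_{20},h_{21})\}$ be a Gröbner basis of $N$ with respect to $<_{-1}$ such that the leading monomial of $\boldsymbol h_1$ is of the form $(X^i,0)$ and that of $\boldsymbol h_2$ is of the form $(0,X^j)$. Put $\hat h_i:=\mu(\boldsymbol h_i)$, and let $f_1,f_2\in\mathbb F_{2^s}[X]$ be the (unique) polynomials with $\mu^{-1}(\sigma)=f_1\boldsymbol h_1+f_2\boldsymbol h_2$. Let $J\subseteq\mathbb F_{2^s}^*$, let $m,\rho\ge 1$ be integers, and for $x\in\mathbb F_{2^s}^*$ put $m_x:=m$ if $x\in J$ and $m_x:=0$ otherwise. Let $M(\boldsymbol m,\rho)$ be the set of all polynomials $R=\sum_{j=0}^{\rho}\sum_i a_{ij}X^iY^jZ^{\rho-j}\in\mathbb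 F_{2^s}[X,Y,Z]$ whose multiplicity at the point $(x^2,\hat h_2(x),\hat h_1(x))$ is at least $m_{x^{-1}}$ for every $x\in\mathbb F_{2^s}^*$ (the multiplicity at a point is the least total order of a Hasse derivative that does not vanish there, and $\infty$ for the zero polynomial), and let $\widetilde M(\boldsymbol m,\rho):=\{R(X,Y,1) : R\in M(\boldsymbol m,\rho)\}\subseteq\mathbb F_{2^s}[X,Y]$. Put $w:=2\deg(h_{21})-t-\tfrac12$; the $(1,w)$-weighted degree of a non-zero polynomial in $X,Y$ is the maximum of $i+wj$ over all monomials $X^iY^j$ appearing in it. If $$m\cdot|I\cap J|>\begin{cases}\dfrac{|J|\,m(m+1)}{2(\rho+1)}+\dfrac{\rho}{2}\Big(\varepsilon-t-\dfrac12\Big) & \text{if }\rho\text{ is odd},\\[2ex] \dfrac{|J|\,m(m+1)+1}{2(\rho+1)}+\dfrac{\rho}{2}\Big(\varepsilon-t-\dfrac12\Big) & \text{if }\rho\text{ is even},\end{cases}$$ and if $f_2\neq 0$, then every non-zero polynomial $Q(X,Y)$ of minimal $(1,w)$-weighted degree in $\widetilde M(\boldsymbol m,\rho)\smallsetminus\{0\}$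 is divisible by $Yf_2(X)+f_1(X)$ in $\mathbb F_{2^s}[X,Y]$. -/

import Mathlib

open Polynomial

namespace BinaryBCH

/-! ### Weighted degrees, Hasse derivatives and multiplicities -/

section MultivariatePolynomials

variable {K : Type*} [Field K]

/-- The `w`-weighted degree of a polynomial, with value `⊥` (i.e. `-∞`) at `0`. -/
noncomputable def wdeg {n : ℕ} (w : Fin n → ℚ) (f : MvPolynomial (Fin n) K) : WithBot ℚ :=
  f.support.sup fun d => ((∑ i, w i * (d i : ℚ) : ℚ) : WithBot ℚ)

/-- The `d`-th Hasse derivative of `g`: the coefficient of `Y ^ d` in `g (X + Y)`,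
where `g (X + Y)` is viewed as a polynomial in `Y` over `K[X]`. -/
noncomputable def hasse {n : ℕ} (d : Fin n →₀ ℕ) (g : MvPolynomial (Fin n) K) :
    MvPolynomial (Fin n) K :=
  MvPolynomial.coeff d
    (MvPolynomial.aeval
      (fun i => (MvPolynomial.C (MvPolynomial.X i) + MvPolynomial.X i :
        MvPolynomial (Fin n) (MvPolynomial (Fin n) K))) g)

/-- The multiplicity of `g` at the point `a`: the least total weight of an index whose Hasse
derivative does not vanish at `a`, and `⊤` if there is none (i.e. if `g = 0`). -/
noncomputable def mult {n : ℕ} (g : MvPolynomial (Fin n) K) (a : Fin n → K) : ℕ∞ :=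
  ⨅ (d : Fin n →₀ ℕ) (_ : MvPolynomial.eval a (hasse d g) ≠ 0), (d.degree : ℕ∞)

/-- The polynomials in `K[X, Y, Z]` (variables numbered `0, 1, 2`) that are
`(Y, Z)`-homogeneous of `(Y, Z)`-homogeneous degree `ρ`. -/
def homog (K : Type*) [Field K] (ρ : ℕ) : Set (MvPolynomial (Fin 3) K) :=
  {Q | ∀ d ∈ Q.support, d 1 + d 2 = ρ}

/-- De-homogenization `f(X, Y, Z) ↦ f(X, Y, 1)`. -/
noncomputable def dehomog (f : MvPolynomial (Fin 3) K) : MvPolynomial (Fin 2) K :=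
  MvPolynomial.aeval ![MvPolynomial.X 0, MvPolynomial.X 1, 1] f

/-- A univariate polynomial `p(X)` regarded as an element of `K[X, Y]`. -/
noncomputable def inX (p : K[X]) : MvPolynomial (Fin 2) K :=
  Polynomial.aeval (MvPolynomial.X 0) p

end MultivariatePolynomials

/-! ### Monomial orderings and Gröbner bases on `K[X]²` -/

section Groebner

variable {K : Type*} [Field K]

/-- The monomial ordering `<_w` on `K[X]²`. The monomial `(X ^ j, 0)` is represented by
`Sum.inl j`, the monomial `(0, X ^ j)` by `Sum.inr j`. -/
def monLT (w : ℚ) : ℕ ⊕ ℕ → ℕ ⊕ ℕ → Prop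
  | Sum.inl i, Sum.inl j => i < j
  | Sum.inr i, Sum.inr j => i < j
  | Sum.inl i, Sum.inr j => (i : ℚ) ≤ (j : ℚ) + w
  | Sum.inr i, Sum.inl j => (i : ℚ) + w < (j : ℚ)

/-- The coefficient of a monomial in an element of `K[X]²`. -/
noncomputable def monCoeff (p : K[X] × K[X]) : ℕ ⊕ ℕ → K
  | Sum.inl j => p.1.coeff j
  | Sum.inr j => p.2.coeff j

/-- Divisibility of monomials in `K[X]²`: same unit vector, and division of the powers of `X`. -/
def monDvd : ℕ ⊕ ℕ → ℕ ⊕ ℕ → Prop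
  | Sum.inl i, Sum.inl j => i ≤ j
  | Sum.inr i, Sum.inr j => i ≤ j
  | _, _ => False

/-- `a` is the leading monomial of `p` with respect to `<_w`. -/
def IsLeadingMonomial (w : ℚ) (p : K[X] × K[X]) (a : ℕ ⊕ ℕ) : Prop :=
  monCoeff p a ≠ 0 ∧ ∀ b, monCoeff p b ≠ 0 → b ≠ a → monLT w b a

/-- `G` is a Gröbner basis of the submodule `N` of `K[X]²` with respect to `<_w`: it is a finite
subset of `N`, and the leading monomial of every non-zero element of `N` is divisible by the
leading monomial of some element of `G`. -/
def IsGroebnerBasis (w : ℚ) (N : Submodule K[X] (K[X] × K[X])) (G : Set (K[X] × K[X])) : Prop :=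
  G.Finite ∧ G ⊆ N ∧
    ∀ p ∈ N, p ≠ 0 → ∃ g ∈ G, ∃ a b,
      IsLeadingMonomial w g a ∧ IsLeadingMonomial w p b ∧ monDvd a b

end Groebner

/-! ### Odd and even parts, and the gluing map `μ` -/

section Parts

variable {K : Type*} [Field K]

/-- The even part `f₀ + f₂ X + f₄ X² + ⋯` of `f`. -/
noncomputable def evenPart (f : K[X]) : K[X] := contract 2 f

/-- The odd part `f₁ + f₃ X + f₅ X² + ⋯` of `f`. -/
noncomputable def oddPart (f : K[X]) : K[X] := contract 2 (divX f)

theorem coeff_evenPart (f : K[X]) (j : ℕ) : (evenPart f).coeff j = f.coeff (2 * j) := by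
  rw [evenPart, coeff_contract two_ne_zero, mul_comm]

theorem coeff_oddPart (f : K[X]) (j : ℕ) : (oddPart f).coeff j = f.coeff (2 * j + 1) := by
  rw [oddPart, coeff_contract two_ne_zero, coeff_divX, mul_comm]

/-- The bijection `μ(u, v) = v(X²) + X u(X²)`, with inverse `f ↦ (odd part, even part)`. -/
noncomputable def mu : (K[X] × K[X]) ≃+ K[X] where
  toFun p := expand K 2 p.2 + X * expand K 2 p.1
  invFun f := (oddPart f, evenPart f)
  left_inv p := by
    have h2 : ¬ (2 ∣ 1) := by norm_num
    ext j
    · simp only [coeff_oddPart, coeff_add, coeff_X_mul]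
      rw [coeff_expand two_pos, coeff_expand two_pos, if_neg (by omega), if_pos (by omega)]
      simp
    · simp only [coeff_evenPart, coeff_add]
      rw [coeff_expand two_pos, if_pos (by omega)]
      cases j with
      | zero => simp
      | succ j =>
        rw [show 2 * (j + 1) = (2 * j + 1) + 1 by ring, coeff_X_mul, coeff_expand two_pos,
          if_neg (by omega)]
        simp [show (2 * j + 1 + 1) / 2 = j + 1 by omega]
  right_inv f := by
    ext k
    simp only [coeff_add]
    obtain ⟨j, rfl | rfl⟩ := Nat.even_or_odd' k
    · rw [coeff_expand two_pos, if_pos (by omega)]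
      cases j with
      | zero => simp [coeff_evenPart]
      | succ j =>
        rw [show 2 * (j + 1) = (2 * j + 1) + 1 by ring, coeff_X_mul, coeff_expand two_pos,
          if_neg (by omega), coeff_evenPart]
        simp [show 2 * ((2 * j + 1 + 1) / 2) = 2 * j + 1 + 1 by omega]
    · rw [coeff_X_mul, coeff_expand two_pos, coeff_expand two_pos, if_neg (by omega),
        if_pos (by omega), coeff_oddPart]
      simp
  map_add' p q := by
    simp only [Prod.fst_add, Prod.snd_add, map_add]
    ring

end Parts

/-! ### Binary BCH codes, syndromes and the solution module -/

section Code

variable {K : Type*} [Field K] [Algebra (ZMod 2) K]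

/-- The polynomial `f₀ + f₁ X + ⋯ + f_{n-1} X ^ (n-1)` of a binary vector `f`. -/
noncomputable def vecPoly {n : ℕ} (f : Fin n → ZMod 2) : (ZMod 2)[X] :=
  ∑ i : Fin n, C (f i) * X ^ (i : ℕ)

/-- The cyclic binary code of length `n` with zeroes `γ, γ³, …, γ ^ (2t-1)` and their conjugates. -/
def bchCode (n t : ℕ) (γ : Kˣ) : Set (Fin n → ZMod 2) :=
  {c | ∀ i < t, ∀ k : ℕ, Polynomial.aeval (((γ : K) ^ (2 * i + 1)) ^ (2 ^ k)) (vecPoly c) = 0}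

/-- The syndrome polynomial `S₁ + S₂ X + ⋯ + S_{2t} X ^ (2t-1)` of the received word `y`, where
`S_j = y(γ ^ j)`. -/
noncomputable def syndromePoly {n : ℕ} (t : ℕ) (γ : Kˣ) (y : Fin n → ZMod 2) : K[X] :=
  ∑ j ∈ Finset.range (2 * t), C (Polynomial.aeval ((γ : K) ^ (j + 1)) (vecPoly y)) * X ^ j

/-- The set of erroneous coordinates of the error vector `e`; coordinate number `i` is labelled
by `γ ^ i`. -/
def errorSet [DecidableEq K] {n : ℕ} (γ : Kˣ) (e : Fin n → ZMod 2) : Finset Kˣ :=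
  (Finset.univ.filter fun i : Fin n => e i ≠ 0).image fun i : Fin n => γ ^ (i : ℕ)

end Code

section Solution

variable {K : Type*} [Field K]

/-- The error locator polynomial of a set of error locations. -/
noncomputable def elp (I : Finset Kˣ) : K[X] := ∏ α ∈ I, (1 + C (α : K) * X)

/-- The power series `S_even(X) / (1 + X S_odd(X))`. -/
noncomputable def modifiedSyndrome (S : K[X]) : PowerSeries K :=
  (evenPart S : PowerSeries K) * (1 + PowerSeries.X * (oddPart S : PowerSeries K))⁻¹

/-- The solution module of the modified key equation: all pairs `(u, v)` with
`u ≡ S_even / (1 + X S_odd) · v mod X ^ t`. -/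
noncomputable def solModule (t : ℕ) (S : K[X]) : Submodule K[X] (K[X] × K[X]) where
  carrier := {p | (PowerSeries.X : PowerSeries K) ^ t ∣
    (p.1 : PowerSeries K) - modifiedSyndrome S * (p.2 : PowerSeries K)}
  zero_mem' := by simp
  add_mem' {p q} hp hq := by
    have h := dvd_add hp hq
    simp only [Set.mem_ofPred_eq, Prod.fst_add, Prod.snd_add, Polynomial.coe_add]
    convert h using 1
    ring
  smul_mem' c p hp := by
    have h := Dvd.dvd.mul_left hp (c : PowerSeries K)
    simp only [Set.mem_ofPred_eq, Prod.smul_fst, Prod.smul_snd, smul_eq_mul, Polynomial.coe_mul]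
    convert h using 1
    ring

/-- `{h₁, h₂}` is a Gröbner basis, with respect to `<_{-1}`, of the solution module, such that
the leading monomial of `h₁` is on the left and that of `h₂` is on the right. -/
def IsSolBasis (t : ℕ) (S : K[X]) (h₁ h₂ : K[X] × K[X]) : Prop :=
  IsGroebnerBasis (-1) (solModule t S) {h₁, h₂} ∧
    (∃ j, IsLeadingMonomial (-1) h₁ (Sum.inl j)) ∧ (∃ j, IsLeadingMonomial (-1) h₂ (Sum.inr j))

/-- The set of all `Q ∈ K[X, Y, Z]`, `(Y, Z)`-homogeneous of degree `ρ`, whose multiplicity at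
`(x², ĥ₂(x), ĥ₁(x))` is at least `m_{x⁻¹}`, for all `x ∈ K*`; here `ĥᵢ = μ(hᵢ)`. -/
def interpModule (h₁ h₂ : K[X] × K[X]) (m : Kˣ → ℕ) (ρ : ℕ) : Set (MvPolynomial (Fin 3) K) :=
  {Q | Q ∈ homog K ρ ∧ ∀ x : Kˣ,
    (m x⁻¹ : ℕ∞) ≤ mult Q ![(x : K) ^ 2, (mu h₂).eval (x : K), (mu h₁).eval (x : K)]}

/-- The image of `interpModule` under de-homogenization. -/
def interpModuleDehomog (h₁ h₂ : K[X] × K[X]) (m : Kˣ → ℕ) (ρ : ℕ) :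
    Set (MvPolynomial (Fin 2) K) :=
  dehomog '' interpModule h₁ h₂ m ρ

/-- `Q` is a non-zero element of `V` of minimal `(1, w)`-weighted degree among all non-zero
elements of `V`. -/
def IsMinimizer (w : ℚ) (V : Set (MvPolynomial (Fin 2) K)) (Q : MvPolynomial (Fin 2) K) : Prop :=
  Q ∈ V ∧ Q ≠ 0 ∧ ∀ P ∈ V, P ≠ 0 → wdeg ![1, w] Q ≤ wdeg ![1, w] P

end Solution

end BinaryBCH

/-! Under `mu` the ordering `<_{-1}` becomes the ordering by degree, so ĥ₁ has odd degree 2a+1 and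
ĥ₂ even degree 2b. A determinant argument gives t ≤ a + b. In σ = f₁(X²)ĥ₁ + f₂(X²)ĥ₂ the two
summands have degrees of different parity and cannot cancel, which bounds deg f₁ and deg f₂ in terms
of ε. As σ is squarefree, f₁ and f₂ are coprime.

Write Q = ∑ q_j Y^j and consider G = ∑ q_j f₁^j f₂^(ρ-j). If α ∈ I ∩ J and x = α⁻¹, then σ(x) = 0,
so in characteristic 2 the vectors (f₁(x²), f₂(x²)) and (ĥ₂(x), ĥ₁(x)) are proportional; by
homogeneity G has a zero of order at least m at x². A count of monomials against linear conditions
(`exists_homogPoly_of_card_lt`) shows that the minimal Q has weighted degree less than a threshold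
Δ, and `degree_sum_lt` turns this into deg G < m|I ∩ J|. Hence G = 0, so Y = f₁/f₂ is a root of Q,
and coprimality makes Y f₂ + f₁ a factor over K[X], not merely over K(X). -/

namespace BinaryBCH

/-! ### Multiplicity through Taylor shifts -/

section Mult

variable {K : Type*} [Field K] {n : ℕ}

/-- The substitution `g(X) ↦ g(a + X)`. -/
noncomputable def shift (a : Fin n → K) : MvPolynomial (Fin n) K →ₐ[K] MvPolynomial (Fin n) K :=
  MvPolynomial.aeval fun i => MvPolynomial.C (a i) + MvPolynomial.X i

theorem eval_hasse (d : Fin n →₀ ℕ) (g : MvPolynomial (Fin n) K) (a : Fin n → K) :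
    MvPolynomial.eval a (hasse d g) = MvPolynomial.coeff d (shift a g) := by
  have h : shift a g = MvPolynomial.map (MvPolynomial.eval a) (MvPolynomial.aeval
      (fun i => (MvPolynomial.C (MvPolynomial.X i) + MvPolynomial.X i :
        MvPolynomial (Fin n) (MvPolynomial (Fin n) K))) g) := by
    induction g using MvPolynomial.induction_on with
    | C c =>
      simp only [shift, MvPolynomial.algHom_C, MvPolynomial.algebraMap_eq]
      rw [IsScalarTower.algebraMap_apply K (MvPolynomial (Fin n) K)]
      simp [MvPolynomial.algebraMap_eq]
    | add p q hp hq => simp only [map_add, hp, hq]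
    | mul_X p i hp => simp only [map_mul, hp]; simp [shift]
  rw [h, MvPolynomial.coeff_map, hasse]

/-- Multiplicity becomes membership in a power of the ideal at the origin, which is stable under
substitutions without constant term. -/
theorem le_mult_iff (g : MvPolynomial (Fin n) K) (a : Fin n → K) (m : ℕ) :
    (m : ℕ∞) ≤ mult g a ↔ shift a g ∈ MvPolynomial.idealOfVars (Fin n) K ^ m := by
  rw [MvPolynomial.mem_pow_idealOfVars_iff', mult]
  simp only [le_iInf_iff, eval_hasse, Nat.cast_le]
  refine forall_congr' fun d => ?_
  rw [← not_imp_not, not_le, not_not]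

/-- Substituting polynomials that meet the point `a` at `x` into a polynomial of multiplicity at
least `m` at `a` yields a polynomial with a zero of order at least `m` at `x`. -/
theorem pow_dvd_aeval_of_le_mult {g : MvPolynomial (Fin n) K} {a : Fin n → K} {m : ℕ}
    (hg : (m : ℕ∞) ≤ mult g a) (p : Fin n → K[X]) (x : K) (hp : ∀ i, (p i).eval x = a i) :
    (X - C x) ^ m ∣ MvPolynomial.aeval p g := by
  let φ : MvPolynomial (Fin n) K →ₐ[K] K[X] := MvPolynomial.aeval fun i => p i - C (a i)
  have h1 : MvPolynomial.aeval p g = φ (shift a g) := by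
    have : MvPolynomial.aeval p = φ.comp (shift a) := by
      ext i
      simp [φ, shift]
    rw [this]; rfl
  have h2 : (MvPolynomial.idealOfVars (Fin n) K).map φ ≤ Ideal.span {X - C x} := by
    rw [MvPolynomial.idealOfVars, Ideal.map_span, Ideal.span_le]
    rintro _ ⟨_, ⟨i, rfl⟩, rfl⟩
    simp only [φ, MvPolynomial.aeval_X, SetLike.mem_coe, Ideal.mem_span_singleton]
    rw [dvd_iff_isRoot]
    simp [hp]
  rw [h1, ← Ideal.mem_span_singleton, ← Ideal.span_singleton_pow]
  refine Ideal.pow_right_mono h2 m ?_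
  rw [← Ideal.map_pow]
  exact Ideal.mem_map_of_mem _ ((le_mult_iff _ _ _).1 hg)

end Mult

/-! ### Polynomials homogeneous in Y and Z -/

section Homog

variable {K : Type*} [Field K]

/-- The polynomial `∑ q_j(X) Y ^ j Z ^ (ρ - j)`. -/
noncomputable def homogPoly (ρ : ℕ) : (ℕ → K[X]) →ₗ[K] MvPolynomial (Fin 3) K where
  toFun q := ∑ j ∈ Finset.range (ρ + 1), Polynomial.aeval (MvPolynomial.X 0) (q j) *
    MvPolynomial.X 1 ^ j * MvPolynomial.X 2 ^ (ρ - j)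
  map_add' p q := by simp [add_mul, Finset.sum_add_distrib]
  map_smul' c q := by simp [Finset.smul_sum]

theorem homogPoly_apply (ρ : ℕ) (q : ℕ → K[X]) : homogPoly ρ q =
    ∑ j ∈ Finset.range (ρ + 1), Polynomial.aeval (MvPolynomial.X 0) (q j) *
      MvPolynomial.X 1 ^ j * MvPolynomial.X 2 ^ (ρ - j) := rfl

theorem exists_eq_homogPoly {ρ : ℕ} {Q : MvPolynomial (Fin 3) K} (hQ : Q ∈ homog K ρ) :
    ∃ q, Q = homogPoly ρ q := by
  suffices Q ∈ LinearMap.range (homogPoly (K := K) ρ) by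
    obtain ⟨q, hq⟩ := this
    exact ⟨q, hq.symm⟩
  rw [Q.as_sum]
  refine Submodule.sum_mem _ fun d hd => ?_
  have hd' := hQ d hd
  refine ⟨Pi.single (d 1) (monomial (d 0) (Q.coeff d)), ?_⟩
  rw [homogPoly_apply, Finset.sum_eq_single (d 1)]
  · rw [Pi.single_eq_same, MvPolynomial.monomial_eq,
      Finsupp.prod_fintype _ _ (fun _ => pow_zero _), Fin.prod_univ_three,
      show ρ - d 1 = d 2 by omega, aeval_monomial]
    simp [MvPolynomial.algebraMap_eq, mul_assoc]
  · intro j _ hj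
    simp [Pi.single_eq_of_ne hj]
  · intro h
    exact absurd (Finset.mem_range.2 (by omega)) h

/-- The variable weights that count the `(Y, Z)`-degree. -/
abbrev yzWeight : Fin 3 → ℕ := ![0, 1, 1]

theorem mem_homog_of_isWeightedHomogeneous {ρ : ℕ} {Q : MvPolynomial (Fin 3) K}
    (hQ : Q.IsWeightedHomogeneous yzWeight ρ) : Q ∈ homog K ρ := by
  intro d hd
  rw [← hQ (MvPolynomial.mem_support_iff.1 hd)]
  simp [Finsupp.weight_apply, Finsupp.sum_fintype, Fin.sum_univ_three]

theorem isWeightedHomogeneous_aeval_homogPoly (ρ : ℕ) (q : ℕ → K[X])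
    {L : Fin 3 → MvPolynomial (Fin 3) K}
    (hL : ∀ i, (L i).IsWeightedHomogeneous yzWeight (yzWeight i)) :
    (MvPolynomial.aeval L (homogPoly ρ q)).IsWeightedHomogeneous yzWeight ρ := by
  rw [homogPoly_apply, map_sum]
  refine MvPolynomial.IsWeightedHomogeneous.sum _ _ _ fun j hj => ?_
  have hj : j ≤ ρ := Nat.lt_succ_iff.1 (Finset.mem_range.1 hj)
  simp only [map_mul, map_pow, MvPolynomial.aeval_X, ← Polynomial.aeval_algHom_apply]
  have h0 : (Polynomial.aeval (L 0) (q j)).IsWeightedHomogeneous yzWeight 0 := by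
    rw [Polynomial.aeval_eq_sum_range]
    refine MvPolynomial.IsWeightedHomogeneous.sum _ _ _ fun i _ => ?_
    rw [MvPolynomial.smul_eq_C_mul]
    convert (MvPolynomial.isWeightedHomogeneous_C yzWeight ((q j).coeff i)).mul
      ((hL 0).pow i) using 1
    simp
  convert (h0.mul ((hL 1).pow j)).mul ((hL 2).pow (ρ - j)) using 1
  simp; omega

theorem homogPoly_mem_homog (ρ : ℕ) (q : ℕ → K[X]) : homogPoly ρ q ∈ homog K ρ := by
  refine mem_homog_of_isWeightedHomogeneous ?_
  have := isWeightedHomogeneous_aeval_homogPoly ρ q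
    (MvPolynomial.isWeightedHomogeneous_X K yzWeight)
  rwa [MvPolynomial.aeval_X_left_apply] at this

theorem dehomog_homogPoly (ρ : ℕ) (q : ℕ → K[X]) : dehomog (homogPoly ρ q) =
    ∑ j ∈ Finset.range (ρ + 1), inX (q j) * MvPolynomial.X 1 ^ j := by
  rw [homogPoly_apply, dehomog, map_sum]
  refine Finset.sum_congr rfl fun j _ => ?_
  simp only [map_mul, map_pow, MvPolynomial.aeval_X, inX, ← Polynomial.aeval_algHom_apply]
  simp

/-- Homogeneity pulls out c^ρ, so proportional pairs (u, v) give the same order of vanishing. -/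
theorem aeval_homogPoly (ρ : ℕ) (q : ℕ → K[X]) (c : K) (u v : K[X]) :
    MvPolynomial.aeval ![X, C c * u, C c * v] (homogPoly ρ q) =
      C (c ^ ρ) * ∑ j ∈ Finset.range (ρ + 1), q j * u ^ j * v ^ (ρ - j) := by
  rw [homogPoly_apply, map_sum, Finset.mul_sum]
  refine Finset.sum_congr rfl fun j hj => ?_
  have hj : j ≤ ρ := Nat.lt_succ_iff.1 (Finset.mem_range.1 hj)
  simp only [map_mul, map_pow, MvPolynomial.aeval_X, ← Polynomial.aeval_algHom_apply]
  simp only [Matrix.cons_val_zero, Matrix.cons_val_one, Matrix.cons_val, aeval_X_left_apply,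
    mul_pow]
  conv_rhs => rw [← Nat.add_sub_of_le hj, pow_add]
  simp only [Nat.add_sub_cancel_left]
  ring

theorem coeff_inX_mul_X_pow (p : K[X]) (j : ℕ) (d : Fin 2 →₀ ℕ) :
    (inX p * MvPolynomial.X 1 ^ j).coeff d = if d 1 = j then p.coeff (d 0) else 0 := by
  have h (i : ℕ) : (MvPolynomial.X 0 ^ i * MvPolynomial.X 1 ^ j : MvPolynomial (Fin 2) K) =
      MvPolynomial.monomial (Finsupp.single 0 i + Finsupp.single 1 j) 1 := by
    rw [MvPolynomial.X_pow_eq_monomial, MvPolynomial.X_pow_eq_monomial,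
      MvPolynomial.monomial_mul, one_mul]
  have h' (i : ℕ) : (Finsupp.single 0 i + Finsupp.single 1 j : Fin 2 →₀ ℕ) = d ↔
      i = d 0 ∧ d 1 = j := by
    simp [Finsupp.ext_iff, Fin.forall_fin_two, eq_comm]
  rw [inX, Polynomial.aeval_eq_sum_range, Finset.sum_mul, MvPolynomial.coeff_sum]
  simp only [smul_mul_assoc, h, MvPolynomial.coeff_smul, MvPolynomial.coeff_monomial, h']
  by_cases hj : d 1 = j
  · simp only [hj, and_true, smul_eq_mul, mul_ite, mul_one, mul_zero, if_true,
      Finset.sum_ite_eq', Finset.mem_range]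
    split_ifs with h0
    · rfl
    · rw [coeff_eq_zero_of_natDegree_lt (by omega)]
  · simp [hj]

theorem coeff_dehomog_homogPoly (ρ : ℕ) (q : ℕ → K[X]) (d : Fin 2 →₀ ℕ) :
    (dehomog (homogPoly ρ q)).coeff d = if d 1 ≤ ρ then (q (d 1)).coeff (d 0) else 0 := by
  rw [dehomog_homogPoly, MvPolynomial.coeff_sum]
  simp [coeff_inX_mul_X_pow]

theorem wdeg_dehomog_homogPoly_lt (ρ : ℕ) (q : ℕ → K[X]) (w Δ : ℚ) :
    wdeg ![1, w] (dehomog (homogPoly ρ q)) < (Δ : WithBot ℚ) ↔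
      ∀ j ≤ ρ, ∀ i, (q j).coeff i ≠ 0 → (i : ℚ) + w * j < Δ := by
  rw [wdeg, Finset.sup_lt_iff (WithBot.bot_lt_coe Δ)]
  simp only [MvPolynomial.mem_support_iff, coeff_dehomog_homogPoly, WithBot.coe_lt_coe,
    Fin.sum_univ_two]
  constructor
  · intro h j hj i hi
    have := h (Finsupp.single 0 i + Finsupp.single 1 j) (by simpa [hj] using hi)
    simpa using this
  · intro h d hd
    split_ifs at hd with hj
    · simpa using h _ hj _ hd
    · exact absurd rfl hd

end Homog

/-! ### Interpolation by counting, and extraction of a linear factor -/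

section Interpolation

variable {K : Type*} [Field K]

/-- For `(Y, Z)`-homogeneous polynomials, multiplicity `m` at a point with `(y, z) ≠ (0, 0)`
amounts to at most `m (m + 1) / 2` linear conditions. -/
theorem exists_linear_conditions (ρ m : ℕ) (x y z : K) (hyz : y ≠ 0 ∨ z ≠ 0) :
    ∃ ℓ : (Σ j : Fin m, Fin (m - j)) → MvPolynomial (Fin 3) K →ₗ[K] K,
      ∀ Q ∈ homog K ρ, (∀ k, ℓ k Q = 0) → (m : ℕ∞) ≤ mult Q ![x, y, z] := by
  obtain ⟨α, β, hαβ⟩ : ∃ α β : K, α * z - β * y = 1 := by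
    rcases hyz with h | h
    · exact ⟨0, -y⁻¹, by field_simp; ring⟩
    · exact ⟨z⁻¹, 0, by field_simp; ring⟩
  have hC : (MvPolynomial.C α * MvPolynomial.C z - MvPolynomial.C β * MvPolynomial.C y :
      MvPolynomial (Fin 3) K) = 1 := by
    rw [← map_mul, ← map_mul, ← map_sub, hαβ, map_one]
  -- `L` is an affine change of variables, of determinant 1 on (Y, Z), sending (0, 0, 1) to (x, y,
  -- z). `M` is its inverse followed by recentring at (0, 0, 1): `M 0` and `M 1` have no constant
  -- term, while `M 2` has constant term 1.
  let L : Fin 3 → MvPolynomial (Fin 3) K := ![MvPolynomial.C x + MvPolynomial.X 0,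
    MvPolynomial.C α * MvPolynomial.X 1 + MvPolynomial.C y * MvPolynomial.X 2,
    MvPolynomial.C β * MvPolynomial.X 1 + MvPolynomial.C z * MvPolynomial.X 2]
  let M : Fin 3 → MvPolynomial (Fin 3) K := ![MvPolynomial.X 0,
    MvPolynomial.C z * MvPolynomial.X 1 - MvPolynomial.C y * MvPolynomial.X 2,
    1 - MvPolynomial.C β * MvPolynomial.X 1 + MvPolynomial.C α * MvPolynomial.X 2]
  have hL : ∀ i, (L i).IsWeightedHomogeneous yzWeight (yzWeight i) := by
    have hX (c : K) (i : Fin 3) :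
        (MvPolynomial.C c * MvPolynomial.X i : MvPolynomial (Fin 3) K).IsWeightedHomogeneous
          yzWeight (yzWeight i) := by
      convert (MvPolynomial.isWeightedHomogeneous_C yzWeight c).mul
        (MvPolynomial.isWeightedHomogeneous_X K yzWeight i) using 1
      simp
    intro i
    fin_cases i
    · exact (MvPolynomial.isWeightedHomogeneous_C _ _).add
        (MvPolynomial.isWeightedHomogeneous_X K yzWeight 0)
    · exact (hX α 1).add (hX y 2)
    · exact (hX β 1).add (hX z 2)
  have hcomp : shift ![x, y, z] = (MvPolynomial.aeval M).comp (MvPolynomial.aeval L) := by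
    refine MvPolynomial.algHom_ext fun i => ?_
    fin_cases i
    · simp [shift, L, M, MvPolynomial.algebraMap_eq]
    · simp only [shift, L, M, MvPolynomial.aeval_X, AlgHom.comp_apply, map_add, map_mul,
        MvPolynomial.algHom_C, MvPolynomial.algebraMap_eq, Fin.mk_one, Matrix.cons_val]
      linear_combination (-MvPolynomial.X 1) * hC
    · simp only [shift, L, M, MvPolynomial.aeval_X, AlgHom.comp_apply, map_add, map_mul,
        MvPolynomial.algHom_C, MvPolynomial.algebraMap_eq, Fin.reduceFinMk, Matrix.cons_val]
      linear_combination (-MvPolynomial.X 2) * hC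
  -- It suffices to kill the coefficients of X^i Y^j Z^(ρ-j) with i + j < m, the power of Z being
  -- forced by homogeneity. Indices with j > ρ give superfluous but harmless conditions.
  refine ⟨fun k => (MvPolynomial.lcoeff K (Finsupp.equivFunOnFinite.symm
    ![(k.2 : ℕ), (k.1 : ℕ), ρ - k.1])).comp (MvPolynomial.aeval L).toLinearMap,
    fun Q hQ hℓ => ?_⟩
  obtain ⟨q, rfl⟩ := exists_eq_homogPoly hQ
  rw [le_mult_iff, hcomp, AlgHom.comp_apply]
  set P := MvPolynomial.aeval L (homogPoly ρ q) with hP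
  have hPh := mem_homog_of_isWeightedHomogeneous (isWeightedHomogeneous_aeval_homogPoly ρ q hL)
  rw [← hP] at hPh
  rw [P.as_sum, map_sum]
  refine Ideal.sum_mem _ fun d hd => ?_
  have hM0 : M 0 ∈ MvPolynomial.idealOfVars (Fin 3) K := Ideal.subset_span ⟨0, rfl⟩
  have hM1 : M 1 ∈ MvPolynomial.idealOfVars (Fin 3) K :=
    Ideal.sub_mem _ (Ideal.mul_mem_left _ _ (Ideal.subset_span ⟨1, rfl⟩))
      (Ideal.mul_mem_left _ _ (Ideal.subset_span ⟨2, rfl⟩))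
  have hdeg : m ≤ d 0 + d 1 := by
    by_contra! hlt
    have h0 := hℓ ⟨⟨d 1, by omega⟩, ⟨d 0, by simp only; omega⟩⟩
    have hd' : (Finsupp.equivFunOnFinite.symm ![d 0, d 1, ρ - d 1] : Fin 3 →₀ ℕ) = d := by
      have := hPh d hd
      ext i
      fin_cases i <;> simp
      omega
    simp only [LinearMap.comp_apply, AlgHom.toLinearMap_apply, ← hP, hd',
      MvPolynomial.lcoeff_apply] at h0
    exact MvPolynomial.mem_support_iff.1 hd h0
  rw [MvPolynomial.aeval_monomial, Finsupp.prod_fintype _ _ (fun _ => pow_zero _),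
    Fin.prod_univ_three]
  refine Ideal.mul_mem_left _ _ (Ideal.mul_mem_right _ _ (Ideal.pow_le_pow_right hdeg ?_))
  rw [pow_add]
  exact Ideal.mul_mem_mul (Ideal.pow_mem_pow hM0 _) (Ideal.pow_mem_pow hM1 _)

theorem card_sigma_fin_sub (m : ℕ) :
    2 * Fintype.card (Σ j : Fin m, Fin (m - j)) = m * (m + 1) := by
  simp only [Fintype.card_sigma, Fintype.card_fin]
  rw [Fin.sum_univ_eq_sum_range (fun j => m - j) m]
  induction m with
  | zero => simp
  | succ m ih =>
    rw [Finset.sum_range_succ']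
    simp only [Nat.add_sub_add_right, Nat.sub_zero, mul_add, ih]
    ring

/-- If there are more monomials of weighted degree less than `Δ` than there are linear conditions,
some non-zero interpolation polynomial has weighted degree less than `Δ`. -/
theorem exists_homogPoly_of_card_lt {ι : Type*} (T : Finset ι) (x y z : ι → K)
    (hyz : ∀ k ∈ T, y k ≠ 0 ∨ z k ≠ 0) (ρ m : ℕ) (w Δ : ℚ)
    (h : (T.card : ℚ) * (m * (m + 1)) < 2 * (ρ + 1) * (Δ - ρ * w / 2)) :
    ∃ q : ℕ → K[X], wdeg ![1, w] (dehomog (homogPoly ρ q)) < (Δ : WithBot ℚ) ∧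
      dehomog (homogPoly ρ q) ≠ 0 ∧
      ∀ k ∈ T, (m : ℕ∞) ≤ mult (homogPoly ρ q) ![x k, y k, z k] := by
  classical
  have hℓ (k : T) := exists_linear_conditions ρ m (x k) (y k) (z k) (hyz k k.2)
  choose ℓ hℓ using hℓ
  -- `N j` counts the i ≥ 0 with i + w j < Δ; the natural ceiling is 0 when there are none, so
  -- summing the lower bounds Δ - w j remains valid.
  let N : Fin (ρ + 1) → ℕ := fun j => ⌈Δ - w * j⌉₊
  let E : (∀ j : Fin (ρ + 1), Fin (N j) → K) →ₗ[K] ℕ → K[X] := LinearMap.pi fun j =>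
    if hj : j < ρ + 1 then
      ((degreeLT K (N ⟨j, hj⟩)).subtype.comp
        (degreeLTEquiv K (N ⟨j, hj⟩)).symm.toLinearMap).comp (LinearMap.proj (⟨j, hj⟩ : Fin (ρ + 1)))
    else 0
  have hE (v : ∀ j : Fin (ρ + 1), Fin (N j) → K) (j : Fin (ρ + 1)) :
      E v j = ((degreeLTEquiv K (N j)).symm (v j) : K[X]) := by
    simp only [E, LinearMap.pi_apply, dif_pos j.2]
    rfl
  let F : (∀ j : Fin (ρ + 1), Fin (N j) → K) →ₗ[K]
      (T × (Σ j : Fin m, Fin (m - j)) → K) :=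
    LinearMap.pi fun k => (ℓ k.1 k.2).comp ((homogPoly ρ).comp E)
  have hlt : Module.finrank K (T × (Σ j : Fin m, Fin (m - j)) → K) <
      Module.finrank K (∀ j : Fin (ρ + 1), Fin (N j) → K) := by
    rw [Module.finrank_pi, Module.finrank_pi_fintype, Fintype.card_prod, Fintype.card_coe]
    simp only [Module.finrank_pi, Fintype.card_fin]
    have h1 : ∑ j : Fin (ρ + 1), (Δ - w * (j : ℕ)) = (ρ + 1) * (Δ - ρ * w / 2) := by
      rw [Fin.sum_univ_eq_sum_range (fun j : ℕ => Δ - w * (j : ℚ)) (ρ + 1),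
        Finset.sum_sub_distrib, ← Finset.mul_sum]
      have h2 : ∑ j ∈ Finset.range (ρ + 1), (j : ℚ) = ρ * (ρ + 1) / 2 := by
        have := Finset.sum_range_id_mul_two (ρ + 1)
        rw [Nat.add_sub_cancel] at this
        rw [← Nat.cast_sum, eq_div_iff two_ne_zero]
        norm_cast
        rw [this]; ring
      rw [h2]
      simp
      ring
    have h3 : ∑ j : Fin (ρ + 1), (Δ - w * (j : ℕ)) ≤ ((∑ j, N j : ℕ) : ℚ) := by
      push_cast
      exact Finset.sum_le_sum fun j _ => Nat.le_ceil _
    have h4 : ((2 * Fintype.card (Σ j : Fin m, Fin (m - j)) : ℕ) : ℚ) = m * (m + 1) := by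
      rw [card_sigma_fin_sub]; push_cast; ring
    rw [← Nat.cast_lt (α := ℚ)]
    refine lt_of_lt_of_le ?_ h3
    rw [h1]
    rw [← h4] at h
    push_cast at h ⊢
    linarith
  obtain ⟨v, hv, hv0⟩ := Submodule.exists_mem_ne_zero_of_ne_bot
    (LinearMap.ker_ne_bot_of_finrank_lt (f := F) hlt)
  refine ⟨E v, ?_, ?_, fun k hk => ?_⟩
  · rw [wdeg_dehomog_homogPoly_lt]
    intro j hj i hi
    have hj' : j < ρ + 1 := by omega
    have hEj := hE v ⟨j, hj'⟩
    simp only at hEj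
    rw [hEj] at hi
    have hdeg := mem_degreeLT.1 ((degreeLTEquiv K (N ⟨j, hj'⟩)).symm (v ⟨j, hj'⟩)).2
    have : i < N ⟨j, hj'⟩ := by
      by_contra! hle
      exact hi (coeff_eq_zero_of_degree_lt (hdeg.trans_le (by exact_mod_cast hle)))
    have := Nat.lt_ceil.1 this
    simp only at this
    linarith
  · intro h0
    refine hv0 (funext fun j => ?_)
    refine (degreeLTEquiv K (N j)).symm.injective (Subtype.ext ?_)
    rw [← hE, Pi.zero_apply, map_zero, ZeroMemClass.coe_zero]
    ext i
    have h1 := coeff_dehomog_homogPoly ρ (E v) (Finsupp.single 0 i + Finsupp.single 1 (j : ℕ))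
    rw [h0] at h1
    simpa [Nat.lt_succ_iff.1 j.2] using h1.symm
  · refine hℓ ⟨k, hk⟩ _ (homogPoly_mem_homog _ _) fun l => ?_
    exact congrFun (LinearMap.mem_ker.1 hv) (⟨k, hk⟩, l)

/-- A root `-a / b` with coprime `a`, `b` of a polynomial gives rise to a linear factor. -/
theorem linear_dvd_of_sum_eq_zero {k R A : Type*} [CommSemiring k] [CommRing R] [IsDomain R]
    [CommRing A] [Algebra k R] [Algebra k A] (φ : R →ₐ[k] A) (Y : A) {a b : R}
    (hab : IsCoprime a b) (hb : b ≠ 0) (ρ : ℕ) (q : ℕ → R)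
    (h : ∑ j ∈ Finset.range (ρ + 1), q j * (-a) ^ j * b ^ (ρ - j) = 0) :
    Y * φ b + φ a ∣ ∑ j ∈ Finset.range (ρ + 1), φ (q j) * Y ^ j := by
  induction ρ generalizing q with
  | zero => simp_all
  | succ ρ ih =>
    have hsplit (q : ℕ → R) : ∑ j ∈ Finset.range (ρ + 1), q j * (-a) ^ j * b ^ (ρ + 1 - j) =
        b * ∑ j ∈ Finset.range (ρ + 1), q j * (-a) ^ j * b ^ (ρ - j) := by
      rw [Finset.mul_sum]
      refine Finset.sum_congr rfl fun j hj => ?_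
      rw [Nat.succ_sub (Nat.lt_succ_iff.1 (Finset.mem_range.1 hj)), pow_succ]
      ring
    rw [Finset.sum_range_succ, hsplit, Nat.sub_self, pow_zero, mul_one] at h
    obtain ⟨c, hc⟩ : b ∣ q (ρ + 1) := by
      have h1 : b ∣ (-a) ^ (ρ + 1) * q (ρ + 1) :=
        ⟨-∑ j ∈ Finset.range (ρ + 1), q j * (-a) ^ j * b ^ (ρ - j), by linear_combination h⟩
      exact (hab.symm.neg_right.pow_right).dvd_of_dvd_mul_left h1
    -- Since b divides the top coefficient, subtracting (bY + a) c Y^ρ removes the term of degree ρ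
    -- + 1 and changes only the coefficient at ρ.
    let q' : ℕ → R := fun j => q j - if j = ρ then c * a else 0
    have hq' : ∑ j ∈ Finset.range (ρ + 1), q' j * (-a) ^ j * b ^ (ρ - j) =
        ∑ j ∈ Finset.range (ρ + 1), q j * (-a) ^ j * b ^ (ρ - j) - c * a * (-a) ^ ρ := by
      simp [q', sub_mul, Finset.sum_sub_distrib]
    have h2 := ih q' (by
      refine (mul_eq_zero.1 ?_).resolve_left hb
      rw [hq', ← h, hc]
      ring)
    have h3 : ∑ j ∈ Finset.range (ρ + 1), φ (q' j) * Y ^ j =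
        ∑ j ∈ Finset.range (ρ + 1), φ (q j) * Y ^ j - φ (c * a) * Y ^ ρ := by
      simp only [q', map_sub, sub_mul, Finset.sum_sub_distrib]
      congr 1
      rw [Finset.sum_eq_single ρ] <;> simp +contextual
    rw [Finset.sum_range_succ, hc]
    have h4 : ∑ j ∈ Finset.range (ρ + 1), φ (q j) * Y ^ j + φ (b * c) * Y ^ (ρ + 1) =
        ∑ j ∈ Finset.range (ρ + 1), φ (q' j) * Y ^ j + (Y * φ b + φ a) * (φ c * Y ^ ρ) := by
      rw [h3, map_mul, map_mul]
      ring
    rw [h4]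
    exact dvd_add h2 (dvd_mul_right _ _)

end Interpolation

/-! ### The solution module and its Gröbner basis under `mu` -/

section SolutionBasis

variable {K : Type*} [Field K]

theorem mu_apply (p : K[X] × K[X]) : mu p = expand K 2 p.2 + X * expand K 2 p.1 := rfl

theorem mu_smul (c : K[X]) (p : K[X] × K[X]) : mu (c • p) = expand K 2 c * mu p := by
  simp only [mu_apply, Prod.smul_fst, Prod.smul_snd, smul_eq_mul, map_mul]
  ring

theorem coeff_mu_odd (p : K[X] × K[X]) (j : ℕ) : (mu p).coeff (2 * j + 1) = p.1.coeff j := by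
  rw [← coeff_oddPart]
  exact congrArg (fun r : K[X] × K[X] => r.1.coeff j) (mu.symm_apply_apply p)

theorem coeff_mu_even (p : K[X] × K[X]) (j : ℕ) : (mu p).coeff (2 * j) = p.2.coeff j := by
  rw [← coeff_evenPart]
  exact congrArg (fun r : K[X] × K[X] => r.2.coeff j) (mu.symm_apply_apply p)

/-- The exponent of the image of a monomial under `mu`. -/
def monExp : ℕ ⊕ ℕ → ℕ
  | Sum.inl j => 2 * j + 1
  | Sum.inr j => 2 * j

theorem coeff_mu_monExp (p : K[X] × K[X]) (a : ℕ ⊕ ℕ) :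
    (mu p).coeff (monExp a) = monCoeff p a := by
  cases a with
  | inl j => exact coeff_mu_odd p j
  | inr j => exact coeff_mu_even p j

theorem monLT_neg_one_iff (a b : ℕ ⊕ ℕ) : monLT (-1) a b ↔ monExp a < monExp b := by
  rcases a with i | i <;> rcases b with j | j <;> simp only [monLT, monExp]
  · omega
  · rw [← sub_eq_add_neg, le_sub_iff_add_le]
    norm_cast
    omega
  · rw [← sub_eq_add_neg, sub_lt_iff_lt_add]
    norm_cast
    omega
  · omega

theorem exists_monExp_eq (k : ℕ) : ∃ a, monExp a = k := by
  obtain ⟨j, rfl | rfl⟩ := Nat.even_or_odd' k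
  exacts [⟨Sum.inr j, rfl⟩, ⟨Sum.inl j, rfl⟩]

/-- Under `mu`, the ordering `<_{-1}` becomes the ordering by degree. -/
theorem IsLeadingMonomial.degree_mu {p : K[X] × K[X]} {a : ℕ ⊕ ℕ}
    (h : IsLeadingMonomial (-1) p a) : (mu p).degree = monExp a := by
  refine le_antisymm ((degree_le_iff_coeff_zero _ _).2 fun k hk => ?_) (le_degree_of_ne_zero ?_)
  · obtain ⟨b, rfl⟩ := exists_monExp_eq k
    have hk : monExp a < monExp b := by exact_mod_cast hk
    by_contra hb
    rw [coeff_mu_monExp] at hb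
    have hba : b ≠ a := by rintro rfl; exact lt_irrefl _ hk
    exact lt_asymm hk ((monLT_neg_one_iff _ _).1 (h.2 b hb hba))
  · rw [coeff_mu_monExp]
    exact h.1

theorem degree_components_of_degree_mu_odd {p : K[X] × K[X]} {a : ℕ}
    (h : (mu p).degree = (2 * a + 1 : ℕ)) : p.1.degree = a ∧ p.2.degree ≤ a := by
  have h' := (degree_le_iff_coeff_zero _ _).1 h.le
  refine ⟨le_antisymm ((degree_le_iff_coeff_zero _ _).2 fun k hk => ?_)
    (le_degree_of_ne_zero ?_), (degree_le_iff_coeff_zero _ _).2 fun k hk => ?_⟩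
  · rw [← coeff_mu_odd]
    have hk : a < k := by exact_mod_cast hk
    exact h' _ (by exact_mod_cast (by omega : 2 * a + 1 < 2 * k + 1))
  · rw [← coeff_mu_odd]
    exact coeff_ne_zero_of_eq_degree h
  · rw [← coeff_mu_even]
    have hk : a < k := by exact_mod_cast hk
    exact h' _ (by exact_mod_cast (by omega : 2 * a + 1 < 2 * k))

theorem degree_components_of_degree_mu_even {p : K[X] × K[X]} {b : ℕ}
    (h : (mu p).degree = (2 * b : ℕ)) : p.2.degree = b ∧ p.1.degree < b := by
  have h' := (degree_le_iff_coeff_zero _ _).1 h.le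
  refine ⟨le_antisymm ((degree_le_iff_coeff_zero _ _).2 fun k hk => ?_)
    (le_degree_of_ne_zero ?_), (degree_lt_iff_coeff_zero _ _).2 fun k hk => ?_⟩
  · rw [← coeff_mu_even]
    have hk : b < k := by exact_mod_cast hk
    exact h' _ (by exact_mod_cast (by omega : 2 * b < 2 * k))
  · rw [← coeff_mu_even]
    exact coeff_ne_zero_of_eq_degree h
  · rw [← coeff_mu_odd]
    exact h' _ (by exact_mod_cast (by omega : 2 * b < 2 * k + 1))

/-- The determinant of (h₁, h₂) has degree exactly a + b, because the leading monomials lie on the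
diagonal, and it is divisible by X^t, because both rows satisfy the same congruence. -/
theorem le_add_of_mem_solModule {t a b : ℕ} {S : K[X]} {h₁ h₂ : K[X] × K[X]}
    (m₁ : h₁ ∈ solModule t S) (m₂ : h₂ ∈ solModule t S)
    (d₁ : (mu h₁).degree = (2 * a + 1 : ℕ)) (d₂ : (mu h₂).degree = (2 * b : ℕ)) :
    t ≤ a + b := by
  obtain ⟨h11, h12⟩ := degree_components_of_degree_mu_odd d₁
  obtain ⟨h22, h21⟩ := degree_components_of_degree_mu_even d₂
  have hdeg : (h₁.1 * h₂.2 - h₁.2 * h₂.1).degree = (a + b : ℕ) := by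
    rw [degree_sub_eq_left_of_degree_lt, degree_mul, h11, h22]
    · rfl
    · rw [degree_mul, degree_mul, h11, h22]
      exact (by gcongr : h₁.2.degree + h₂.1.degree ≤ a + h₂.1.degree).trans_lt
        (WithBot.add_lt_add_left WithBot.coe_ne_bot h21)
  have hdvd : (PowerSeries.X : PowerSeries K) ^ t ∣
      ((h₁.1 * h₂.2 - h₁.2 * h₂.1 : K[X]) : PowerSeries K) := by
    have e₁ : (PowerSeries.X : PowerSeries K) ^ t ∣
      (h₁.1 : PowerSeries K) - modifiedSyndrome S * (h₁.2 : PowerSeries K) := m₁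
    have e₂ : (PowerSeries.X : PowerSeries K) ^ t ∣
      (h₂.1 : PowerSeries K) - modifiedSyndrome S * (h₂.2 : PowerSeries K) := m₂
    have := dvd_sub (e₁.mul_right (h₂.2 : PowerSeries K)) (e₂.mul_right (h₁.2 : PowerSeries K))
    convert this using 1
    push_cast
    ring
  by_contra! hlt
  have := PowerSeries.X_pow_dvd_iff.1 hdvd _ hlt
  rw [Polynomial.coeff_coe] at this
  exact coeff_ne_zero_of_eq_degree hdeg this

theorem X_pow_mem_solModule (t : ℕ) (S : K[X]) : ((0, X ^ t) : K[X] × K[X]) ∈ solModule t S := by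
  change (PowerSeries.X : PowerSeries K) ^ t ∣
    ((0 : K[X]) : PowerSeries K) - modifiedSyndrome S * ((X ^ t : K[X]) : PowerSeries K)
  rw [Polynomial.coe_zero, zero_sub, dvd_neg, Polynomial.coe_pow, Polynomial.coe_X]
  exact dvd_mul_left _ _

/-- A Gröbner basis generates: a zero of all `mu g`, `g ∈ G`, is a zero of `mu p` for every `p`
in the submodule. -/
theorem IsGroebnerBasis.eval_mu_eq_zero {N : Submodule K[X] (K[X] × K[X])}
    {G : Set (K[X] × K[X])} (hG : IsGroebnerBasis (-1) N G) {x : K}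
    (hx : ∀ g ∈ G, (mu g).eval x = 0) (p : K[X] × K[X]) (hp : p ∈ N) : (mu p).eval x = 0 := by
  induction hd : (mu p).degree using WellFoundedLT.induction generalizing p with
  | ind d ih =>
    subst hd
    by_cases hp0 : p = 0
    · simp [hp0]
    obtain ⟨g, hgG, a, b, ha, hb, hab⟩ := hG.2.2 p hp hp0
    have hga := ha.degree_mu
    have hpb := hb.degree_mu
    -- Monomial divisibility keeps the component, hence the parity of the degree under `mu`; the gap
    -- 2k is cleared by the scalar X^k, which `mu` turns into X^(2k).
    obtain ⟨k, hk⟩ : ∃ k, monExp b = 2 * k + monExp a := by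
      rcases a with i | i <;> rcases b with j | j <;> simp only [monDvd] at hab
      · exact ⟨j - i, by simp only [monExp]; omega⟩
      · exact ⟨j - i, by simp only [monExp]; omega⟩
    have hg0 : mu g ≠ 0 := by rw [← degree_ne_bot, hga]; exact WithBot.coe_ne_bot
    have hp0 : mu p ≠ 0 := by rw [← degree_ne_bot, hpb]; exact WithBot.coe_ne_bot
    let c : K[X] := C ((mu p).leadingCoeff / (mu g).leadingCoeff) * X ^ k
    have hc : (mu p).leadingCoeff / (mu g).leadingCoeff ≠ 0 :=
      div_ne_zero (leadingCoeff_ne_zero.2 hp0) (leadingCoeff_ne_zero.2 hg0)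
    have hmu : mu (c • g) = C ((mu p).leadingCoeff / (mu g).leadingCoeff) * X ^ (2 * k) * mu g := by
      rw [mu_smul]
      simp [c, pow_mul]
    have hdeg : (mu (c • g)).degree = (mu p).degree := by
      rw [hmu, degree_mul, degree_C_mul_X_pow _ hc, hga, hpb, hk]
      rfl
    have hlt : (mu (p - c • g)).degree < (mu p).degree := by
      rw [map_sub]
      refine degree_sub_lt_left hdeg.symm hp0 ?_
      rw [hmu, leadingCoeff_mul, leadingCoeff_C_mul_X_pow,
        div_mul_cancel₀ _ (leadingCoeff_ne_zero.2 hg0)]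
    have h := ih _ hlt (p - c • g) (N.sub_mem hp (N.smul_mem _ (hG.2.1 hgG))) rfl
    rw [map_sub, eval_sub, mu_smul, eval_mul, hx g hgG, mul_zero, sub_zero] at h
    exact h

/-- A common zero of ĥ₁ and ĥ₂ would be a zero of `mu (0, X ^ t)` = X^(2t), which vanishes only at
0. -/
theorem IsSolBasis.eval_mu_ne_zero {t : ℕ} {S : K[X]} {h₁ h₂ : K[X] × K[X]}
    (h : IsSolBasis t S h₁ h₂) {x : K} (hx : x ≠ 0) :
    (mu h₂).eval x ≠ 0 ∨ (mu h₁).eval x ≠ 0 := by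
  by_contra! hcon
  have := h.1.eval_mu_eq_zero (x := x) (by rintro g (rfl | rfl); exacts [hcon.2, hcon.1])
    _ (X_pow_mem_solModule t S)
  simp [mu_apply, hx] at this

/-- There is no cancellation in `mu (f₁ h₁ + f₂ h₂)`, since one summand has odd degree and the
other one even degree. -/
theorem natDegree_le_of_mu_eq {h₁ h₂ : K[X] × K[X]} {a b : ℕ} {f₁ f₂ : K[X]}
    (d₁ : (mu h₁).degree = (2 * a + 1 : ℕ)) (d₂ : (mu h₂).degree = (2 * b : ℕ)) :
    (f₁ ≠ 0 → 2 * f₁.natDegree + 2 * a + 1 ≤ (mu (f₁ • h₁ + f₂ • h₂)).natDegree) ∧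
    (f₂ ≠ 0 → 2 * f₂.natDegree + 2 * b ≤ (mu (f₁ • h₁ + f₂ • h₂)).natDegree) := by
  have hd (f : K[X]) (hf : f ≠ 0) (h : K[X] × K[X]) (e : ℕ) (d : (mu h).degree = e) :
      (mu (f • h)).natDegree = 2 * f.natDegree + e := by
    rw [mu_smul, natDegree_mul ((expand_ne_zero two_pos).2 hf) (by rw [← degree_ne_bot, d]; simp),
      natDegree_expand, natDegree_eq_of_degree_eq_some d, mul_comm]
  rw [map_add]
  by_cases hf₁ : f₁ = 0
  · refine ⟨fun h => absurd hf₁ h, fun h => ?_⟩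
    rw [hf₁, zero_smul, map_zero, zero_add, hd _ h _ _ d₂]
  by_cases hf₂ : f₂ = 0
  · refine ⟨fun h => ?_, fun h => absurd hf₂ h⟩
    rw [hf₂, zero_smul, map_zero, add_zero, hd _ h _ _ d₁, add_assoc]
  have e₁ := hd _ hf₁ _ _ d₁
  have e₂ := hd _ hf₂ _ _ d₂
  rcases lt_or_gt_of_ne (by omega : (mu (f₁ • h₁)).natDegree ≠ (mu (f₂ • h₂)).natDegree)
    with h | h
  · rw [natDegree_add_eq_right_of_natDegree_lt h]
    omega
  · rw [natDegree_add_eq_left_of_natDegree_lt h]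
    omega

theorem natDegree_elp_le (I : Finset Kˣ) : (elp I).natDegree ≤ I.card := by
  refine (natDegree_prod_le _ _).trans ?_
  rw [Finset.card_eq_sum_ones]
  refine Finset.sum_le_sum fun α _ => ?_
  compute_degree

theorem squarefree_elp (I : Finset Kˣ) : Squarefree (elp I) := by
  refine Finset.squarefree_prod_of_pairwise_isCoprime (fun α _ β _ hne => ?_) fun α _ => ?_
  · refine IsCoprime.isRelPrime ?_
    have hne' : (β : K) - α ≠ 0 := sub_ne_zero.2 fun h => hne (Units.ext h.symm)
    refine ⟨C (((β : K) - α)⁻¹ * β), -C (((β : K) - α)⁻¹ * α), ?_⟩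
    have : C (((β : K) - α)⁻¹ * β) * (1 + C (α : K) * X) +
        -C (((β : K) - α)⁻¹ * α) * (1 + C (β : K) * X) = C (((β : K) - α)⁻¹ * (β - α)) := by
      simp only [C_mul, C_sub]
      ring
    rw [this, inv_mul_cancel₀ hne', C_1]
  · refine (irreducible_of_degree_eq_one ?_).squarefree
    rw [add_comm, ← C_1, degree_linear α.ne_zero]

/-- A common divisor d of f₁ and f₂ puts d(X²) into the glued polynomial, and over a perfect field
of characteristic 2 d(X²) is a square. -/
theorem isCoprime_of_squarefree_mu [CharP K 2] [PerfectRing K 2] {h₁ h₂ : K[X] × K[X]}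
    {f₁ f₂ : K[X]} (h : Squarefree (mu (f₁ • h₁ + f₂ • h₂))) : IsCoprime f₁ f₂ := by
  refine IsRelPrime.isCoprime fun d hd₁ hd₂ => ?_
  have hd : expand K 2 d ∣ mu (f₁ • h₁ + f₂ • h₂) := by
    rw [map_add, mu_smul, mu_smul]
    exact dvd_add ((_root_.map_dvd _ hd₁).mul_right _) ((_root_.map_dvd _ hd₂).mul_right _)
  rw [polynomial_expand_eq, sq] at hd
  have hu := h _ hd
  rw [isUnit_iff_degree_eq_zero, degree_map] at hu
  exact isUnit_iff_degree_eq_zero.2 hu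

end SolutionBasis

/-! ### From multiplicities and degrees to the linear factor -/

section Divisibility

variable {K : Type*} [Field K]

theorem sum_eq_zero_of_pow_dvd {ι : Type*} (T : Finset ι) (z : ι → K)
    (hz : Set.InjOn z T) (m : ℕ) (g : K[X]) (hdvd : ∀ k ∈ T, (X - C (z k)) ^ m ∣ g)
    (hdeg : g.degree < (m * T.card : ℕ)) : g = 0 := by
  have h1 : ∏ k ∈ T, (X - C (z k)) ^ m ∣ g := by
    refine Finset.prod_dvd_of_coprime (fun k hk l hl hkl => ?_) hdvd
    exact (isCoprime_X_sub_C_of_isUnit_sub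
      (sub_ne_zero.2 fun h => hkl (hz hk hl h)).isUnit).pow
  refine eq_zero_of_dvd_of_degree_lt h1 (hdeg.trans_le ?_)
  rw [degree_prod]
  simp [mul_comm]

/-- The weight w and the threshold Δ are tuned so that the j-th summand has degree less than m M + j
(t - a - b). The 1/2 in w offsets the one coming from the odd degree 2a + 1. -/
theorem degree_sum_lt {f₁ f₂ : K[X]} {q : ℕ → K[X]} {a b t ε m M ρ : ℕ} {w Δ : ℚ}
    (hw : w = 2 * (b : ℚ) - t - 1 / 2) (hΔ : Δ = m * M - ρ * ((ε : ℚ) / 2 - b))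
    (hdf₁ : f₁ ≠ 0 → 2 * f₁.natDegree + 2 * a + 1 ≤ ε) (hdf₂ : 2 * f₂.natDegree + 2 * b ≤ ε)
    (htab : t ≤ a + b) (hwdeg : ∀ j ≤ ρ, ∀ i, (q j).coeff i ≠ 0 → (i : ℚ) + w * j < Δ) :
    (∑ j ∈ Finset.range (ρ + 1), q j * f₁ ^ j * f₂ ^ (ρ - j)).degree < (m * M : ℕ) := by
  rw [← mem_degreeLT]
  refine Submodule.sum_mem _ fun j hj => ?_
  have hj : j ≤ ρ := Nat.lt_succ_iff.1 (Finset.mem_range.1 hj)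
  by_cases h0 : q j * f₁ ^ j * f₂ ^ (ρ - j) = 0
  · rw [h0]; exact Submodule.zero_mem _
  rw [mem_degreeLT]
  have hq0 : q j ≠ 0 := by
    intro h; simp [h] at h0
  have e₁ := hwdeg j hj _ (leadingCoeff_ne_zero.2 hq0)
  have e₂ : (j : ℚ) * f₁.natDegree ≤ j * ((ε : ℚ) / 2 - a - 1 / 2) := by
    -- For j = 0 the factor f₁^j is 1 even if f₁ = 0, and then no degree bound on f₁ is available.
    rcases Nat.eq_zero_or_pos j with rfl | hj0
    · simp
    · have hf₁ : f₁ ≠ 0 := by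
        rintro rfl
        simp [hj0.ne'] at h0
      have : (2 * f₁.natDegree + 2 * a + 1 : ℚ) ≤ ε := by
        exact_mod_cast hdf₁ hf₁
      gcongr
      linarith
  have e₃ : ((ρ : ℚ) - j) * f₂.natDegree ≤ (ρ - j) * ((ε : ℚ) / 2 - b) := by
    have : (2 * f₂.natDegree + 2 * b : ℚ) ≤ ε := by
      exact_mod_cast hdf₂
    have : (j : ℚ) ≤ ρ := by exact_mod_cast hj
    exact mul_le_mul_of_nonneg_left (by linarith) (by linarith)
  have e₄ : (j : ℚ) * t ≤ j * (a + b) := by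
    gcongr
    exact_mod_cast htab
  have e₅ : (q j * f₁ ^ j * f₂ ^ (ρ - j)).natDegree ≤
      (q j).natDegree + j * f₁.natDegree + (ρ - j) * f₂.natDegree :=
    natDegree_mul_le_of_le (natDegree_mul_le_of_le le_rfl natDegree_pow_le) natDegree_pow_le
  rw [degree_eq_natDegree h0]
  have e₆ : (((q j).natDegree + j * f₁.natDegree + (ρ - j) * f₂.natDegree : ℕ) : ℚ) <
      (m * M : ℕ) := by
    push_cast [Nat.cast_sub hj]
    rw [hΔ, hw] at e₁
    linarith
  exact_mod_cast e₅.trans_lt (by exact_mod_cast e₆)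

/-- If `μ (f₁ h₁ + f₂ h₂)` vanishes at `x`, then `(f₁ (x²), f₂ (x²))` is proportional to
`(ĥ₂ (x), ĥ₁ (x))`, so that multiplicities carry over by homogeneity. -/
theorem pow_dvd_sum_of_le_mult [CharP K 2] {h₁ h₂ : K[X] × K[X]} {f₁ f₂ : K[X]}
    (hcop : IsCoprime f₁ f₂) {x : K} (hne : (mu h₂).eval x ≠ 0 ∨ (mu h₁).eval x ≠ 0)
    (hroot : (mu (f₁ • h₁ + f₂ • h₂)).eval x = 0) {ρ m : ℕ} {q : ℕ → K[X]}
    (hmult : (m : ℕ∞) ≤ mult (homogPoly ρ q) ![x ^ 2, (mu h₂).eval x, (mu h₁).eval x]) :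
    (X - C (x ^ 2)) ^ m ∣ ∑ j ∈ Finset.range (ρ + 1), q j * f₁ ^ j * f₂ ^ (ρ - j) := by
  rw [map_add, mu_smul, mu_smul, eval_add, eval_mul, eval_mul, expand_eval, expand_eval,
    CharTwo.add_eq_zero] at hroot
  obtain ⟨u, v, huv⟩ := hcop
  have hne' := congrArg (eval (x ^ 2)) huv
  rw [eval_add, eval_mul, eval_mul, eval_one] at hne'
  -- The Bézout identity u f₁ + v f₂ = 1 at x² gives the proportionality factor without dividing by
  -- either value.
  obtain ⟨c, hc₂, hc₁⟩ : ∃ c : K, c * f₁.eval (x ^ 2) = (mu h₂).eval x ∧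
      c * f₂.eval (x ^ 2) = (mu h₁).eval x := by
    refine ⟨u.eval (x ^ 2) * (mu h₂).eval x + v.eval (x ^ 2) * (mu h₁).eval x, ?_, ?_⟩
    · linear_combination v.eval (x ^ 2) * hroot + (mu h₂).eval x * hne'
    · linear_combination -u.eval (x ^ 2) * hroot + (mu h₁).eval x * hne'
  have hc : c ≠ 0 := by
    rintro rfl
    rw [← hc₁, ← hc₂, zero_mul, zero_mul] at hne
    simp at hne
  have hdvd := pow_dvd_aeval_of_le_mult hmult ![X, C c * f₁, C c * f₂] (x ^ 2) (by
    intro i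
    fin_cases i
    · simp
    · simpa using hc₂
    · simpa using hc₁)
  rw [aeval_homogPoly] at hdvd
  exact (isUnit_C.2 (pow_ne_zero ρ hc).isUnit).dvd_mul_left.1 hdvd

theorem linear_factor_dvd_dehomog {f₁ f₂ : K[X]} (hcop : IsCoprime f₁ f₂) (hf₂ : f₂ ≠ 0) (ρ : ℕ)
    (q : ℕ → K[X]) (h : ∑ j ∈ Finset.range (ρ + 1), q j * (-f₁) ^ j * f₂ ^ (ρ - j) = 0) :
    MvPolynomial.X 1 * inX f₂ + inX f₁ ∣ dehomog (homogPoly ρ q) := by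
  have := linear_dvd_of_sum_eq_zero
    (Polynomial.aeval (R := K) (MvPolynomial.X 0 : MvPolynomial (Fin 2) K))
    (MvPolynomial.X 1) hcop hf₂ ρ q h
  rw [dehomog_homogPoly]
  exact this

end Divisibility

/-! ### Assembly of the proof -/

section Main

theorem linear_factor_dvd_of_isMinimizer {K : Type*} [Field K] [DecidableEq K] [CharP K 2]
    [PerfectRing K 2] {t : ℕ} {S : K[X]} {I : Finset Kˣ} {h₁ h₂ : K[X] × K[X]}
    (hbasis : IsSolBasis t S h₁ h₂)
    {f₁ f₂ : K[X]} (hf : mu.symm (elp I) = f₁ • h₁ + f₂ • h₂)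
    {J : Finset Kˣ} {m ρ : ℕ} {w : ℚ}
    (hw : w = 2 * (h₂.2.natDegree : ℚ) - t - 1 / 2)
    (hlist : (m : ℚ) * ((I ∩ J).card : ℚ) >
      if Odd ρ then
        (J.card : ℚ) * (m * (m + 1)) / (2 * (ρ + 1)) + ρ / 2 * ((I.card : ℚ) - t - 1 / 2)
      else
        ((J.card : ℚ) * (m * (m + 1)) + 1) / (2 * (ρ + 1)) +
          ρ / 2 * ((I.card : ℚ) - t - 1 / 2))
    {Q : MvPolynomial (Fin 2) K}
    (hQ : IsMinimizer w
      (interpModuleDehomog h₁ h₂ (fun z => if z ∈ J then m else 0) ρ) Q)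
    (hf₂ : f₂ ≠ 0) :
    MvPolynomial.X 1 * inX f₂ + inX f₁ ∣ Q := by
  have hmu : mu (f₁ • h₁ + f₂ • h₂) = elp I := by rw [← hf, AddEquiv.apply_symm_apply]
  obtain ⟨⟨a, ha⟩, b, hb⟩ := hbasis.2
  have d₁ : (mu h₁).degree = (2 * a + 1 : ℕ) := ha.degree_mu
  have d₂ : (mu h₂).degree = (2 * b : ℕ) := hb.degree_mu
  have hbw : h₂.2.natDegree = b :=
    natDegree_eq_of_degree_eq_some (degree_components_of_degree_mu_even d₂).1
  rw [hbw] at hw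
  have htab : t ≤ a + b :=
    le_add_of_mem_solModule (hbasis.1.2.1 (by simp)) (hbasis.1.2.1 (by simp)) d₁ d₂
  obtain ⟨hdf₁, hdf₂⟩ := natDegree_le_of_mu_eq (f₁ := f₁) (f₂ := f₂) d₁ d₂
  rw [hmu] at hdf₁ hdf₂
  have help := natDegree_elp_le I
  have hcop : IsCoprime f₁ f₂ :=
    isCoprime_of_squarefree_mu (h₁ := h₁) (h₂ := h₂) (by rw [hmu]; exact squarefree_elp I)
  obtain ⟨⟨R, ⟨hRhom, hRmult⟩, rfl⟩, hR0, hRmin⟩ := hQ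
  obtain ⟨q, rfl⟩ := exists_eq_homogPoly hRhom
  set Δ : ℚ := m * (I ∩ J).card - ρ * ((I.card : ℚ) / 2 - b) with hΔ
  have hwdeg : wdeg ![1, w] (dehomog (homogPoly ρ q)) < (Δ : WithBot ℚ) := by
    -- In Δ - ρ w / 2 the unknown b cancels, leaving m |I ∩ J| - (ρ/2)(ε - t - 1/2). The bound for
    -- even ρ exceeds the one for odd ρ, so the latter serves both parities.
    have hbound : (J.card : ℚ) * (m * (m + 1)) < 2 * (ρ + 1) * (Δ - ρ * w / 2) := by
      have h1 : (J.card : ℚ) * (m * (m + 1)) / (2 * (ρ + 1)) +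
          ρ / 2 * ((I.card : ℚ) - t - 1 / 2) < (m : ℚ) * ((I ∩ J).card : ℚ) := by
        split_ifs at hlist
        · exact hlist
        · refine lt_of_le_of_lt ?_ hlist
          gcongr
          linarith
      rw [← div_lt_iff₀' (by positivity), hΔ, hw]
      linarith
    obtain ⟨q', hq'deg, hq'0, hq'mult⟩ := exists_homogPoly_of_card_lt J
      (fun α => ((α⁻¹ : Kˣ) : K) ^ 2) (fun α => (mu h₂).eval ((α⁻¹ : Kˣ) : K))
      (fun α => (mu h₁).eval ((α⁻¹ : Kˣ) : K))
      (fun α _ => hbasis.eval_mu_ne_zero (Units.ne_zero _)) ρ m w Δ hbound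
    refine (hRmin _ ⟨_, ⟨homogPoly_mem_homog ρ q', fun z => ?_⟩, rfl⟩ hq'0).trans_lt hq'deg
    simp only
    split_ifs with hz
    · simpa using hq'mult _ hz
    · simp
  rw [wdeg_dehomog_homogPoly_lt] at hwdeg
  have hzero : ∑ j ∈ Finset.range (ρ + 1), q j * f₁ ^ j * f₂ ^ (ρ - j) = 0 := by
    refine sum_eq_zero_of_pow_dvd (I ∩ J) (fun α => ((α⁻¹ : Kˣ) : K) ^ 2)
      (fun α _ β _ h => ?_) m _ (fun α hα => ?_) ?_
    -- The points α⁻² are distinct because inversion and Frobenius are injective.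
    · exact inv_injective (Units.ext (frobenius_inj K 2 h))
    · rw [Finset.mem_inter] at hα
      have hmult := hRmult α⁻¹
      simp only [inv_inv, hα.2, if_true] at hmult
      refine pow_dvd_sum_of_le_mult hcop (hbasis.eval_mu_ne_zero (Units.ne_zero _)) ?_ hmult
      rw [hmu, elp, eval_prod]
      refine Finset.prod_eq_zero hα.1 ?_
      simp [CharTwo.add_self_eq_zero]
    · exact degree_sum_lt hw hΔ (fun h => (hdf₁ h).trans help) ((hdf₂ hf₂).trans help) htab hwdeg
  -- In characteristic 2 the root -f₁/f₂ is f₁/f₂.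
  exact linear_factor_dvd_dehomog hcop hf₂ ρ q (by simpa only [CharTwo.neg_eq] using hzero)

end Main

end BinaryBCH

theorem mainTheorem7 {K : Type*} [Field K] [Fintype K] [DecidableEq K] [Algebra (ZMod 2) K]
    (s t : ℕ) (ht : 1 ≤ t) (hK : Fintype.card K = 2 ^ s)
    (γ : Kˣ) (hγ : IsPrimitiveRoot γ (2 ^ s - 1))
    (x e y : Fin (2 ^ s - 1) → ZMod 2)
    (hx : x ∈ BinaryBCH.bchCode (2 ^ s - 1) t γ) (hy : y = x + e)
    (I : Finset Kˣ) (hI : I = BinaryBCH.errorSet γ e)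
    (h₁ h₂ : K[X] × K[X])
    (hbasis : BinaryBCH.IsSolBasis t (BinaryBCH.syndromePoly t γ y) h₁ h₂)
    (f₁ f₂ : K[X]) (hf : BinaryBCH.mu.symm (BinaryBCH.elp I) = f₁ • h₁ + f₂ • h₂)
    (J : Finset Kˣ) (m ρ : ℕ) (hm : 1 ≤ m) (hρ : 1 ≤ ρ)
    (w : ℚ) (hw : w = 2 * (h₂.2.natDegree : ℚ) - t - 1 / 2)
    (hlist : (m : ℚ) * ((I ∩ J).card : ℚ) >
      if Odd ρ then
        (J.card : ℚ) * (m * (m + 1)) / (2 * (ρ + 1)) + ρ / 2 * ((I.card : ℚ) - t - 1 / 2)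
      else
        ((J.card : ℚ) * (m * (m + 1)) + 1) / (2 * (ρ + 1)) +
          ρ / 2 * ((I.card : ℚ) - t - 1 / 2))
    (Q : MvPolynomial (Fin 2) K)
    (hQ : BinaryBCH.IsMinimizer w
      (BinaryBCH.interpModuleDehomog h₁ h₂ (fun z => if z ∈ J then m else 0) ρ) Q)
    (hf₂ : f₂ ≠ 0) :
    MvPolynomial.X 1 * BinaryBCH.inX f₂ + BinaryBCH.inX f₁ ∣ Q := by
  -- With the characteristic known, perfectness follows from the finiteness of K.
  have : CharP K 2 := charP_of_injective_algebraMap (algebraMap (ZMod 2) K).injective 2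
  exact BinaryBCH.linear_factor_dvd_of_isMinimizer hbasis hf hw hlist hQ hf₂
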